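/- **Setting.** Let $G=(V,E)$ be a finite directed graph. A finite abelian network $\mathcal N$ on $G$ has for each $v\in V$ a finite alphabet $A_v$ and a finite state space $Q_v$; when processor $v$ in state $q$ processes a letter $a\in A_v$, it moves to the state $t_a(q)$ and passes a word $o_a^u(q)\in A_u^*$ to each $u$ with $(v,u)\in E$. The maps $t_a$ ($a \in A_v$) commute, and input words that agree up to permutation produce output words that agree up to permutation. Put $A=\bigsqcup_v A_v$ and $Q=\prod_v Q_v$. A pair $\mathbf x.\mathbf q\in\mathbb Z^A\times Q$ records the letters waiting to be processed and the states; an execution (a word in $A$) is *legal* if each letter is present when it is processed, and *complete* if no positive letter count remains. $\mathcal N$ *halts on all inputs* if $\mathbf x.\mathbf q$ has a complete legal execution for all $\mathbf x\in\mathbb N^A$, $\mathbf q\in Q$; its final state $\mathbf x\triangleright\triangleright\mathbf q$ does not depend on the execution. For a finite commutative monoid $M$ of self-maps of a set $X$, let $e$ be its minimal idempotent (the unique idempotent lying in $Mm$ for every $m\in M$); the elements of $eX$ are called *recurrent*. The monoid is *irreducible* if $X\ne\emptyset$ and for all $x,x'\in X$ there are $m,m'\in M$ with $mx=m'x'$.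 The network is *irreducible* if for every $v$ the monoid $M_v=\langle t_a\rangle_{a\in A_v}$ on $Q_v$ is. A state $\mathbf q\in Q$ is *locally recurrent* if each $\mathbf q_v$ is recurrent for $M_v$, and it is *recurrent* if it is recurrent for the monoid generated by the maps $\mathbf q\mapsto \mathbf 1_a\triangleright\triangleright\mathbf q$, $a\in A$. A *burning element* is a vector $\beta\in\mathbb N^A$ such that for all $\mathbf q\in Q$: $\mathbf q$ is recurrent if and only if $\beta\triangleright\triangleright\mathbf q=\mathbf q$. The *total kernel* is $K=\prod_v K_v\subset\mathbb Z^A$, where $K_v$ is the kernel of the action of $\mathbb Z^{A_v}$ on the recurrent states of $M_v$ (on which each $t_a$ is invertible). Let $\mathbf r_a=\min\{m\ge1: m\mathbf 1_a\in K\}$ and let $D$ be the diagonal matrix with entries $\mathbf r_a$. The *production matrix* $P$ has entries $P_{ba}=\frac1{\mathbf r_a}\#\{$letters $b$ passed when $\mathbf r_a$ letters $a$ are processed from a locally recurrent state$\}$, which does not depend on that state when $\mathcal N$ is irreducible. The *Laplacian* is $L=(I-P)D$. The network is *rectangular* if $K=\prod_{a\in A}\mathbf r_a\mathbb Z$. A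 *burning odometer* is a vector $\mathbf k\in K$ with $\mathbf k\ge\mathbf 1$ and $(I-P)\mathbf k\ge\mathbf 0$; the corresponding burning element is $\beta=(I-P)\mathbf k$. The *sandpilization* of $\mathcal N$, enlarged to allow negative chip counts, acts on chip configurations $\sigma\in\mathbb Z^A$: a letter $a$ with $\sigma_a\ge\mathbf r_a$ may topple, losing $\mathbf r_a$ chips and sending $\mathbf r_aP_{ba}$ chips to each $b\in A$ (so that $\sigma$ becomes $\sigma-L\mathbf 1_a$). A configuration is stable if $\sigma_a<\mathbf r_a$ for all $a$, and $\sigma^\circ$ denotes the stable configuration reached from $\sigma$ by legal topplings. **Corollary 5.6.** Let $\mathcal N$ be a finite irreducible rectangular abelian network that halts on all inputs. Then $\mathcal N$ has a pointwise smallest burning odometer $\mathbf k$, and $\mathbf k=D\mathbf y$ for some $\mathbf y\in\mathbb Z^A$. The configuration $\mathbf r-\mathbf 1-L\mathbf 1$ has a unique stabilization, and the vector $\beta=(I-P)\mathbf k$ corresponding to $\mathbf k$ is a burning element given by $$\beta=L\mathbf y=\mathbf r-\mathbf 1-(\mathbf r-\mathbf 1-L\mathbf 1)^\circ .$$ Moreover,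 $\mathbf 0\le\beta\le\mathbf r$. -/

import Mathlib

section CommutingMaps

variable {I Q : Type*}

/-- The transition monoid of a family of maps `t a : Q → Q`. -/
def transitionMonoid (t : I → Q → Q) : Submonoid (Function.End Q) :=
  Submonoid.closure (Set.range t)

/-- The defining action of the transition monoid is irreducible: the relation
"`m q = m' q'` for some `m, m'`" has exactly one equivalence class. -/
def IsIrreducibleFamily (t : I → Q → Q) : Prop :=
  Nonempty Q ∧ ∀ q q' : Q, ∃ m ∈ transitionMonoid t, ∃ m' ∈ transitionMonoid t, m q = m' q'

/-- `e` is the minimal idempotent of `M`: the idempotent accessible from all of `M`. -/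
def IsMinimalIdempotent (M : Submonoid (Function.End Q)) (e : Function.End Q) : Prop :=
  e ∈ M ∧ e * e = e ∧ ∀ m ∈ M, ∃ m' ∈ M, m' * m = e

/-- The set `eQ` of recurrent states, `e` being the minimal idempotent of the transition monoid. -/
def recurrentStates (t : I → Q → Q) : Set Q :=
  {q | ∃ e, IsMinimalIdempotent (transitionMonoid t) e ∧ ∃ q', e q' = q}

/-- The state reached from `q` after processing the word. -/
def runWord (t : I → Q → Q) : List I → Q → Q
  | [], q => q
  | a :: w, q => runWord t w (t a q)

/-- The output word that results from processing an input word. -/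
def outputWord {B : Type*} (t : I → Q → Q) (o : I → Q → List B) : List I → Q → List B
  | [], _ => []
  | a :: w, q => o a q ++ outputWord t o w (t a q)

end CommutingMaps

/-- An abelian processor with input alphabet `I`, state space `Q` and output alphabets
`B u` indexed by a set `U` of output feeds. -/
structure AbelianProcessor (I Q U : Type*) (B : U → Type*) where
  /-- state transitions -/
  t : I → Q → Q
  /-- message passing functions -/
  o : (u : U) → I → Q → List (B u)
  t_comm : ∀ a b q, t a (t b q) = t b (t a q)
  o_perm : ∀ (w w' : List I), w.Perm w' → ∀ (u : U) (q : Q),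
    (outputWord t (o u) w q).Perm (outputWord t (o u) w' q)

/-- The kernel of the action of `ℤ^I` on the recurrent states of a processor. Each letter acts
invertibly there, so `|w| - |w'|` acts trivially iff `w` and `w'` act in the same way. -/
def AbelianProcessor.kernel {I Q U : Type*} {B : U → Type*} [DecidableEq I]
    (p : AbelianProcessor I Q U B) : Set (I → ℤ) :=
  {k | ∃ w w' : List I, (∀ a, k a = (w.count a : ℤ) - (w'.count a : ℤ)) ∧
    ∀ q ∈ recurrentStates p.t, runWord p.t w q = runWord p.t w' q}

/-- An abelian network on the directed graph `G` with alphabet `Σ v, A v` and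
state space `∀ v, Q v`. -/
structure AbelianNetwork {V : Type*} (G : Digraph V) (A Q : V → Type*) where
  proc : (v : V) → AbelianProcessor (A v) (Q v) {u : V // G.Adj v u} (fun u => A u)

namespace AbelianNetwork

variable {V : Type*} {G : Digraph V} {A Q : V → Type*} (N : AbelianNetwork G A Q)

/-- Every processor is irreducible. -/
def IsIrreducible : Prop := ∀ v, IsIrreducibleFamily (N.proc v).t

def IsLocallyRecurrent (q : ∀ v, Q v) : Prop :=
  ∀ v, q v ∈ recurrentStates (N.proc v).t

variable [DecidableEq V] [∀ v, DecidableEq (A v)]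

/-- The state of the network after processing the letter `a`. -/
def next (a : Σ v, A v) (q : ∀ v, Q v) : ∀ v, Q v :=
  Function.update q a.1 ((N.proc a.1).t a.2 (q a.1))

open Classical in
/-- The number of letters of each type passed when the letter `a` is processed. -/
noncomputable def sent (a : Σ v, A v) (q : ∀ v, Q v) : (Σ v, A v) → ℕ := fun b =>
  if h : G.Adj a.1 b.1 then ((N.proc a.1).o ⟨b.1, h⟩ a.2 (q a.1)).count b.2 else 0

/-- Processing one letter, from the total state `x.q`; the letter counts may become negative. -/
noncomputable def step (c : ((Σ v, A v) → ℤ) × (∀ v, Q v)) (a : Σ v, A v) :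
    ((Σ v, A v) → ℤ) × (∀ v, Q v) :=
  (fun b => c.1 b - (if b = a then 1 else 0) + (N.sent a c.2 b : ℤ), N.next a c.2)

/-- The result `π_w(x.q)` of executing the word `w`. -/
noncomputable def exec (w : List (Σ v, A v)) (c : ((Σ v, A v) → ℤ) × (∀ v, Q v)) :
    ((Σ v, A v) → ℤ) × (∀ v, Q v) :=
  w.foldl N.step c

/-- The execution `w` only processes letters that are present. -/
def IsLegal : List (Σ v, A v) → ((Σ v, A v) → ℤ) × (∀ v, Q v) → Prop
  | [], _ => True
  | a :: w, c => 1 ≤ c.1 a ∧ IsLegal w (N.step c a)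

/-- The execution `w` removes all letters from the network. -/
def IsComplete (w : List (Σ v, A v)) (c : ((Σ v, A v) → ℤ) × (∀ v, Q v)) : Prop :=
  ∀ a, (N.exec w c).1 a ≤ 0

/-- The network halts on the input `x.q`. -/
def HaltsOn (x : (Σ v, A v) → ℤ) (q : ∀ v, Q v) : Prop :=
  ∃ w, N.IsLegal w (x, q) ∧ N.IsComplete w (x, q)

def HaltsOnAllInputs : Prop :=
  ∀ (x : (Σ v, A v) → ℤ) (q : ∀ v, Q v), 0 ≤ x → N.HaltsOn x q

open Classical in
/-- The global action `x ▷▷ q`: the final state after a complete legal execution of `x.q`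
(the final state does not depend on which one). -/
noncomputable def globalAct (x : (Σ v, A v) → ℤ) (q : ∀ v, Q v) : ∀ v, Q v :=
  if h : N.HaltsOn x q then (N.exec h.choose (x, q)).2 else q

/-- `Rec N`, the recurrent states of the action of the global monoid, which is generated by
the maps `τ_a(q) = 1_a ▷▷ q`. -/
noncomputable def recStates : Set (∀ v, Q v) :=
  recurrentStates fun (a : Σ v, A v) (q : ∀ v, Q v) => N.globalAct (Pi.single a 1) q

/-- A burning element: a vector `β ∈ ℕ^A` such that `q` is recurrent iff `β ▷▷ q = q`. -/
def IsBurningElement (β : (Σ v, A v) → ℤ) : Prop :=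
  0 ≤ β ∧ ∀ q : ∀ v, Q v, q ∈ N.recStates ↔ N.globalAct β q = q

/-- The total kernel `K = ∏ K_v`. -/
def totalKernel : Set ((Σ v, A v) → ℤ) :=
  {k | ∀ v, (fun a : A v => k ⟨v, a⟩) ∈ (N.proc v).kernel}

/-- The reset number `r_a`, the least `m ≥ 1` such that `m 1_a ∈ K`. -/
noncomputable def resetNumber (a : Σ v, A v) : ℕ :=
  sInf {m : ℕ | 1 ≤ m ∧ Pi.single a (m : ℤ) ∈ N.totalKernel}

/-- `K = ∏_a r_a ℤ`. -/
def IsRectangular : Prop :=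
  N.totalKernel = {k | ∀ a, (N.resetNumber a : ℤ) ∣ k a}

/-- The number of letters of each type passed in total when the word is processed from `q`. -/
noncomputable def sentByWord : List (Σ v, A v) → (∀ v, Q v) → (Σ v, A v) → ℕ
  | [], _ => 0
  | a :: w, q => N.sent a q + sentByWord w (N.next a q)

open Classical in
/-- `P(r_a 1_a)_b`: the number of letters `b` passed when `r_a` letters `a` are processed, starting
from a locally recurrent state (for an irreducible network, it does not matter which one). -/
noncomputable def resetProduction (a b : Σ v, A v) : ℕ :=
  if h : ∃ q, N.IsLocallyRecurrent q then
    N.sentByWord (List.replicate (N.resetNumber a) a) h.choose b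
  else 0

/-- The production matrix, `P_{ba} = P(r_a 1_a)_b / r_a`. -/
noncomputable def productionMatrix : Matrix (Σ v, A v) (Σ v, A v) ℚ :=
  Matrix.of fun b a => (N.resetProduction a b : ℚ) / (N.resetNumber a : ℚ)

/-- The diagonal matrix `D` of reset numbers. -/
noncomputable def resetMatrix : Matrix (Σ v, A v) (Σ v, A v) ℚ :=
  Matrix.diagonal fun a => (N.resetNumber a : ℚ)

variable [Fintype V] [∀ v, Fintype (A v)]

/-- The Laplacian `L = (I - P) D`. -/
noncomputable def laplacian : Matrix (Σ v, A v) (Σ v, A v) ℚ :=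
  (1 - N.productionMatrix) * N.resetMatrix

/-- The vector `(I - P) k`; for a burning odometer `k` it is the corresponding burning element. -/
noncomputable def correspondingElement (k : (Σ v, A v) → ℤ) : (Σ v, A v) → ℚ :=
  (1 - N.productionMatrix).mulVec fun a => (k a : ℚ)

/-- Burning odometers: the vectors `k` with `(I - P) k ≥ 0`, `k ≥ 1` and `k ∈ K`. -/
def burningOdometers : Set ((Σ v, A v) → ℤ) :=
  {k | 0 ≤ N.correspondingElement k ∧ 1 ≤ k ∧ k ∈ N.totalKernel}

end AbelianNetwork

/-- A toppling network: one unary processor for each letter `a`, which collects `a`'s (chips) and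
topples at its threshold, passing `send a b` letters `b` to the processor of `b`. -/
structure TopplingNetwork (A : Type*) where
  threshold : A → ℕ
  send : A → A → ℕ

namespace TopplingNetwork

variable {A : Type*} (S : TopplingNetwork A)

/-- One legal toppling of a chip configuration; negative chip counts are allowed. -/
def Topples [DecidableEq A] (σ σ' : A → ℤ) : Prop :=
  ∃ a, (S.threshold a : ℤ) ≤ σ a ∧
    σ' = fun b => σ b - (if b = a then (S.threshold a : ℤ) else 0) + (S.send a b : ℤ)

def IsStable (σ : A → ℤ) : Prop := ∀ a, σ a < (S.threshold a : ℤ)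

/-- `σ'` is a stable configuration reached from `σ` by legal topplings. -/
def IsStabilization [DecidableEq A] (σ σ' : A → ℤ) : Prop :=
  Relation.ReflTransGen S.Topples σ σ' ∧ S.IsStable σ'

end TopplingNetwork

/-- The sandpilization: the processor of `a` has states `0, …, r_a - 1`, and passes
`r_a P_{ba} = P(r_a 1_a)_b` letters `b` when it goes from state `r_a - 1` to state `0`. -/
noncomputable def AbelianNetwork.sandpilization {V : Type*} {G : Digraph V} {A Q : V → Type*}
    [DecidableEq V] [∀ v, DecidableEq (A v)] (N : AbelianNetwork G A Q) :
    TopplingNetwork (Σ v, A v) where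
  threshold := N.resetNumber
  send := N.resetProduction

/-! Since `K` is rectangular, burning odometers are the vectors `D y` with `y ≥ 1` and `L y ≥ 0`.
Here `L y` is an integer vector: the chips lost in the sandpilization when each letter `a` topples
`y a` times (`TopplingNetwork.loss`). Write `y = 1 + z` and `σ = r - 1 - L 1`. Then `L (1 + z) ≥ 0`
says exactly that `σ - L z` is stable. By the least action principle for chips, the toppling vector
of a legal stabilization of `σ` is the smallest `z ≥ 0` with this property, so it gives the smallest
odometer, and `L y = r - 1 - σ°`. Stability of `σ°` gives `β ≥ 0`. Legal topplings preserve the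
bound `-1`, which holds for `σ`, and this gives `β ≤ r`.

Two facts about the network remain. Some burning odometer must exist, so that `σ` stabilizes:
`exists_one_le_loss_nonneg` pads a complete execution of a large input to multiples of the reset
numbers. And `L y` must be a burning element (`isBurningElement_loss`). On a recurrent state,
processing `D y` letters restores the state and leaves `D y - β` letters, so `β` acts trivially
after cancellation. Conversely, halting forces multiples of `β` to produce every letter in any
quantity, so a state fixed by `β` lies in the image of the minimal idempotent. -/

/-- Every element of a finite monoid has an idempotent positive power. -/
theorem exists_pow_isIdempotentElem {M : Type*} [Monoid M] [Finite M] (f : M) :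
    ∃ n, n ≠ 0 ∧ IsIdempotentElem (f ^ n) := by
  obtain ⟨i, j, hij, h⟩ := Set.Finite.exists_lt_map_eq_of_forall_mem
    (f := fun n : ℕ => f ^ n) (t := Set.univ) (fun _ => Set.mem_univ _) Set.finite_univ
  obtain ⟨p, rfl⟩ := Nat.exists_eq_add_of_lt hij
  have hper : ∀ n, i ≤ n → ∀ l, f ^ (n + l * (p + 1)) = f ^ n := by
    intro n hn l
    induction l with
    | zero => simp
    | succ l ih =>
      obtain ⟨d, rfl⟩ := Nat.exists_eq_add_of_le hn
      calc f ^ (i + d + (l + 1) * (p + 1)) = f ^ (i + p + 1) * f ^ (d + l * (p + 1)) := by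
            rw [← pow_add]; congr 1; ring
        _ = f ^ i * f ^ (d + l * (p + 1)) := by rw [← h]
        _ = f ^ (i + d + l * (p + 1)) := by rw [← pow_add]; congr 1; ring
        _ = _ := ih
  -- A multiple of the period `p + 1` that is at least the preperiod `i`: doubling this exponent
  -- does not change the power.
  refine ⟨(i + 1) * (p + 1), by positivity, ?_⟩
  rw [IsIdempotentElem, ← pow_add]
  exact hper _ (by nlinarith) _

/-! ### Recurrent states of a family of commuting maps -/

section CommutingMaps

variable {I Q : Type*} {t : I → Q → Q}

theorem runWord_append (w w' : List I) (q : Q) :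
    runWord t (w ++ w') q = runWord t w' (runWord t w q) := by
  induction w generalizing q with
  | nil => rfl
  | cons a w ih => exact ih _

theorem runWord_apply_comm (hc : ∀ a b q, t a (t b q) = t b (t a q)) (w : List I) (a : I) (q : Q) :
    runWord t w (t a q) = t a (runWord t w q) := by
  induction w generalizing q with
  | nil => rfl
  | cons b w ih => rw [runWord, hc, ih]; rfl

theorem runWord_comm (hc : ∀ a b q, t a (t b q) = t b (t a q)) (w w' : List I) (q : Q) :
    runWord t w (runWord t w' q) = runWord t w' (runWord t w q) := by
  induction w generalizing q with
  | nil => rfl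
  | cons b w ih => rw [runWord, runWord, ← ih, runWord_apply_comm hc w']

theorem runWord_perm (hc : ∀ a b q, t a (t b q) = t b (t a q)) {w w' : List I} (h : w.Perm w')
    (q : Q) : runWord t w q = runWord t w' q := by
  induction h generalizing q with
  | nil => rfl
  | cons a _ ih => exact ih _
  | swap a b l => rw [runWord, runWord, runWord, runWord, hc]
  | trans _ _ ih₁ ih₂ => rw [ih₁, ih₂]

theorem mem_transitionMonoid {m : Function.End Q} :
    m ∈ transitionMonoid t ↔ ∃ w, m = runWord t w := by
  constructor
  · intro h
    induction h using Submonoid.closure_induction with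
    | mem m h =>
      obtain ⟨a, rfl⟩ := h
      exact ⟨[a], rfl⟩
    | one => exact ⟨[], rfl⟩
    | mul x y _ _ hx hy =>
      obtain ⟨w, rfl⟩ := hx
      obtain ⟨w', rfl⟩ := hy
      exact ⟨w' ++ w, funext fun q => (runWord_append w' w q).symm⟩
  · rintro ⟨w, rfl⟩
    induction w with
    | nil => exact one_mem _
    | cons a w ih => exact mul_mem ih (Submonoid.subset_closure ⟨a, rfl⟩)

/-- The product of all elements of a finite commutative monoid is divisible by each of them, and so
is its idempotent power. -/
theorem exists_isMinimalIdempotent [Finite Q] (hc : ∀ a b q, t a (t b q) = t b (t a q)) :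
    ∃ e, IsMinimalIdempotent (transitionMonoid t) e := by
  classical
  have : Finite (Function.End Q) := inferInstanceAs (Finite (Q → Q))
  let : CommMonoid (transitionMonoid t) :=
    { (transitionMonoid t).toMonoid with
      mul_comm := by
        rintro ⟨m, hm⟩ ⟨m', hm'⟩
        obtain ⟨w, rfl⟩ := mem_transitionMonoid.1 hm
        obtain ⟨w', rfl⟩ := mem_transitionMonoid.1 hm'
        exact Subtype.ext (funext fun q => runWord_comm hc w w' q) }
  have := Fintype.ofFinite (transitionMonoid t)
  obtain ⟨n, hn, he⟩ := exists_pow_isIdempotentElem (∏ x : transitionMonoid t, x)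
  refine ⟨_, ((∏ x : transitionMonoid t, x) ^ n).2, congrArg Subtype.val he, fun m hm => ?_⟩
  obtain ⟨c, hc⟩ := (Finset.dvd_prod_of_mem (fun x : transitionMonoid t => x)
    (Finset.mem_univ ⟨m, hm⟩)).trans (dvd_pow_self _ hn)
  rw [mul_comm] at hc
  exact ⟨c, c.2, (congrArg Subtype.val hc).symm⟩

/-- A word which acts as the minimal idempotent. -/
theorem exists_minimal_word [Finite Q] (hc : ∀ a b q, t a (t b q) = t b (t a q)) :
    ∃ w₀, (∀ q, q ∈ recurrentStates t ↔ runWord t w₀ q = q) ∧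
      (∀ q, runWord t w₀ q ∈ recurrentStates t) ∧
      ∀ w, ∃ w', ∀ q, runWord t w' (runWord t w q) = runWord t w₀ q := by
  obtain ⟨e, he⟩ := exists_isMinimalIdempotent hc
  obtain ⟨w₀, rfl⟩ := mem_transitionMonoid.1 he.1
  have hmin : ∀ w, ∃ w', ∀ q, runWord t w' (runWord t w q) = runWord t w₀ q := by
    intro w
    obtain ⟨m', hm', h⟩ := he.2.2 (runWord t w) (mem_transitionMonoid.2 ⟨w, rfl⟩)
    obtain ⟨w', rfl⟩ := mem_transitionMonoid.1 hm'
    exact ⟨w', fun q => congrFun h q⟩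
  refine ⟨w₀, fun q => ⟨?_, fun h => ⟨_, he, q, h⟩⟩, fun q => ⟨_, he, q, rfl⟩, hmin⟩
  rintro ⟨e', he', q', rfl⟩
  -- Recurrence allows any minimal idempotent `e'`; it factors through `w₀`, hence its image is
  -- fixed by `w₀`.
  obtain ⟨m', hm', h⟩ := he'.2.2 _ he.1
  obtain ⟨w', rfl⟩ := mem_transitionMonoid.1 hm'
  subst h
  have hidem : runWord t w₀ (runWord t w₀ q') = runWord t w₀ q' := congrFun he.2.1 q'
  change runWord t w₀ (runWord t w' (runWord t w₀ q')) = runWord t w' (runWord t w₀ q')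
  rw [runWord_comm hc, hidem]

theorem runWord_mem_recurrentStates [Finite Q] (hc : ∀ a b q, t a (t b q) = t b (t a q))
    (w : List I) {q : Q} (hq : q ∈ recurrentStates t) : runWord t w q ∈ recurrentStates t := by
  obtain ⟨w₀, h, -, -⟩ := exists_minimal_word hc
  rw [h] at hq ⊢
  rw [runWord_comm hc, hq]

/-- Every word can be completed to one acting as the minimal idempotent, which is the identity on
recurrent states; the completion is a left inverse. -/
theorem runWord_injOn_recurrentStates [Finite Q] (hc : ∀ a b q, t a (t b q) = t b (t a q))
    (w : List I) : Set.InjOn (runWord t w) (recurrentStates t) := by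
  obtain ⟨w₀, h, -, hmin⟩ := exists_minimal_word hc
  obtain ⟨w', hw'⟩ := hmin w
  intro q hq q' hq' heq
  rw [h] at hq hq'
  rw [← hq, ← hq', ← hw', ← hw', heq]

/-- In an irreducible action, the recurrent states are accessible from every state. -/
theorem exists_runWord_eq_of_irreducible [Finite Q] (hc : ∀ a b q, t a (t b q) = t b (t a q))
    (hirr : IsIrreducibleFamily t) (q : Q) {q' : Q}
    (hq' : q' ∈ recurrentStates t) : ∃ w, runWord t w q = q' := by
  obtain ⟨m, hm, m', hm', h⟩ := hirr.2 q q'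
  obtain ⟨w, rfl⟩ := mem_transitionMonoid.1 hm
  obtain ⟨w', rfl⟩ := mem_transitionMonoid.1 hm'
  obtain ⟨w₀, hw₀, -, hmin⟩ := exists_minimal_word hc
  obtain ⟨u, hu⟩ := hmin w'
  exact ⟨w ++ u, by rw [runWord_append, h, hu, ← hw₀]; exact hq'⟩

/-- Each letter acts on the recurrent states as a permutation of finite order. -/
theorem exists_runWord_replicate_eq [Finite Q] (hc : ∀ a b q, t a (t b q) = t b (t a q)) (a : I) :
    ∃ m, 1 ≤ m ∧ ∀ q ∈ recurrentStates t, runWord t (List.replicate m a) q = q := by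
  obtain ⟨i, j, hij, h⟩ := Set.Finite.exists_lt_map_eq_of_forall_mem
    (f := fun n : ℕ => runWord t (List.replicate n a)) (t := Set.univ) (fun _ => Set.mem_univ _)
    Set.finite_univ
  obtain ⟨p, rfl⟩ := Nat.exists_eq_add_of_lt hij
  refine ⟨p + 1, by omega, fun q hq => ?_⟩
  -- Two equal powers of `a` exist by finiteness; injectivity cancels the first `i` letters.
  refine runWord_injOn_recurrentStates hc (List.replicate i a)
    (runWord_mem_recurrentStates hc _ hq) hq ?_
  have h' : runWord t (List.replicate i a) q = runWord t (List.replicate (i + p + 1) a) q :=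
    congrFun h q
  rw [h', ← runWord_append, ← List.replicate_add]
  congr 2; omega

end CommutingMaps

/-! ### The kernel of a processor -/

namespace AbelianProcessor

variable {I Q U : Type*} {B : U → Type*} [DecidableEq I] (p : AbelianProcessor I Q U B)

theorem zero_mem_kernel : (0 : I → ℤ) ∈ p.kernel :=
  ⟨[], [], fun _ => by simp, fun _ _ => rfl⟩

theorem single_mem_kernel_iff [Finite Q] (a : I) (m : ℕ) : Pi.single a (m : ℤ) ∈ p.kernel ↔
    ∀ q ∈ recurrentStates p.t, runWord p.t (List.replicate m a) q = q := by
  constructor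
  · rintro ⟨w, w', hcount, h⟩ q hq
    -- The count condition makes `w` a permutation of `a ^ m` followed by `w'`, so `w'` can be
    -- cancelled.
    refine runWord_injOn_recurrentStates p.t_comm w'
      (runWord_mem_recurrentStates p.t_comm _ hq) hq ?_
    rw [← h q hq, ← runWord_append]
    refine runWord_perm p.t_comm (List.perm_iff_count.2 fun b => ?_) q
    have := hcount b
    rw [List.count_append, List.count_replicate]
    by_cases hb : a = b
    · subst hb
      simp only [Pi.single_eq_same, beq_self_eq_true, if_true] at this ⊢
      omega
    · rw [Pi.single_eq_of_ne (Ne.symm hb)] at this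
      simp only [beq_iff_eq, hb, if_false]
      omega
  · intro h
    refine ⟨List.replicate m a, [], fun b => ?_, h⟩
    by_cases hb : a = b
    · subst hb; simp
    · rw [Pi.single_eq_of_ne (Ne.symm hb)]
      simp [List.count_replicate, hb]

end AbelianProcessor

/-! ### Executions, least action and the global action -/

namespace AbelianNetwork

variable {V : Type*} {G : Digraph V} {A Q : V → Type*} (N : AbelianNetwork G A Q)

theorem sent_congr [∀ v, DecidableEq (A v)] {a : Σ v, A v} {q q' : ∀ v, Q v}
    (h : q a.1 = q' a.1) :
    N.sent a q = N.sent a q' := by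
  funext b
  simp only [sent, h]

theorem next_comm [DecidableEq V] (a b : Σ v, A v) (q : ∀ v, Q v) :
    N.next a (N.next b q) = N.next b (N.next a q) := by
  obtain ⟨v, a⟩ := a
  obtain ⟨u, b⟩ := b
  by_cases h : v = u
  · subst h
    simp [next, (N.proc v).t_comm a b]
  · simp only [next, Function.update_of_ne h, Function.update_of_ne (Ne.symm h)]
    exact (Function.update_comm h _ _ _).symm

variable [DecidableEq V] [∀ v, DecidableEq (A v)]

/-- For letters of one processor this is `o_perm` on two-letter words; letters of different
processors do not see each other's states. -/
theorem sent_add_sent_next (a b : Σ v, A v) (q : ∀ v, Q v) :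
    N.sent a q + N.sent b (N.next a q) = N.sent b q + N.sent a (N.next b q) := by
  obtain ⟨v, a⟩ := a
  obtain ⟨u, b⟩ := b
  by_cases h : v = u
  · subst h
    funext c
    by_cases hc : G.Adj v c.1
    · have := ((N.proc v).o_perm [a, b] [b, a] (List.Perm.swap _ _ _) ⟨c.1, hc⟩ (q v)).count_eq c.2
      simpa [outputWord, sent, next, hc] using this
    · simp [sent, hc]
  · have h₁ : N.sent ⟨u, b⟩ (N.next ⟨v, a⟩ q) = N.sent ⟨u, b⟩ q :=
      N.sent_congr (Function.update_of_ne (Ne.symm h) _ _)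
    have h₂ : N.sent ⟨v, a⟩ (N.next ⟨u, b⟩ q) = N.sent ⟨v, a⟩ q :=
      N.sent_congr (Function.update_of_ne h _ _)
    rw [h₁, h₂, add_comm]

theorem sentByWord_append (w w' : List (Σ v, A v)) (q : ∀ v, Q v) :
    N.sentByWord (w ++ w') q = N.sentByWord w q + N.sentByWord w' (runWord N.next w q) := by
  induction w generalizing q with
  | nil => simp [sentByWord, runWord]
  | cons a w ih => rw [List.cons_append, sentByWord, ih, sentByWord, runWord, add_assoc]

theorem sentByWord_perm {w w' : List (Σ v, A v)} (h : w.Perm w') (q : ∀ v, Q v) :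
    N.sentByWord w q = N.sentByWord w' q := by
  induction h generalizing q with
  | nil => rfl
  | cons a _ ih => rw [sentByWord, sentByWord, ih]
  | swap a b l =>
    simp only [sentByWord]
    rw [← add_assoc, ← add_assoc, sent_add_sent_next, next_comm]
  | trans _ _ ih₁ ih₂ => rw [ih₁, ih₂]

/-- This exchange identity compares the output of one word from two states joined by another word.
-/
theorem sentByWord_append_comm (w w' : List (Σ v, A v)) (q : ∀ v, Q v) :
    N.sentByWord w q + N.sentByWord w' (runWord N.next w q) =
      N.sentByWord w' q + N.sentByWord w (runWord N.next w' q) := by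
  rw [← sentByWord_append, ← sentByWord_append]
  exact N.sentByWord_perm List.perm_append_comm q

theorem exec_eq (w : List (Σ v, A v)) (x : (Σ v, A v) → ℤ) (q : ∀ v, Q v) :
    N.exec w (x, q) =
      (fun b => x b - w.count b + N.sentByWord w q b, runWord N.next w q) := by
  induction w generalizing x q with
  | nil => simp [exec, sentByWord, runWord]
  | cons a w ih =>
    have : N.exec (a :: w) (x, q) = N.exec w (N.step (x, q) a) := rfl
    rw [this, step, ih]
    refine Prod.ext (funext fun b => ?_) rfl
    simp only [sentByWord, List.count_cons, Pi.add_apply, Nat.cast_add]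
    by_cases hb : b = a
    · subst hb; simp; ring
    · simp [hb, Ne.symm hb]; ring

theorem exec_append (w w' : List (Σ v, A v)) (c : ((Σ v, A v) → ℤ) × (∀ v, Q v)) :
    N.exec (w ++ w') c = N.exec w' (N.exec w c) := by
  simp [exec]

theorem exec_perm {w w' : List (Σ v, A v)} (h : w.Perm w')
    (c : ((Σ v, A v) → ℤ) × (∀ v, Q v)) : N.exec w c = N.exec w' c := by
  obtain ⟨x, q⟩ := c
  rw [exec_eq, exec_eq, N.sentByWord_perm h, runWord_perm N.next_comm h]
  simp only [h.count_eq]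

theorem isLegal_append {w w' : List (Σ v, A v)} {c : ((Σ v, A v) → ℤ) × (∀ v, Q v)} :
    N.IsLegal (w ++ w') c ↔ N.IsLegal w c ∧ N.IsLegal w' (N.exec w c) := by
  induction w generalizing c with
  | nil => simp [IsLegal, exec]
  | cons a w ih =>
    simp only [List.cons_append, IsLegal, ih, and_assoc]
    rfl

theorem step_add (x y : (Σ v, A v) → ℤ) (q : ∀ v, Q v) (a : Σ v, A v) :
    N.step (x + y, q) a = (x + (N.step (y, q) a).1, (N.step (y, q) a).2) := by
  refine Prod.ext (funext fun b => ?_) rfl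
  simp only [step, Pi.add_apply]
  ring

theorem exec_add (w : List (Σ v, A v)) (x y : (Σ v, A v) → ℤ) (q : ∀ v, Q v) :
    N.exec w (x + y, q) = (x + (N.exec w (y, q)).1, (N.exec w (y, q)).2) := by
  rw [exec_eq, exec_eq]
  refine Prod.ext (funext fun b => ?_) rfl
  simp only [Pi.add_apply]
  ring

variable {N}

theorem IsLegal.add {w : List (Σ v, A v)} {x y : (Σ v, A v) → ℤ} {q : ∀ v, Q v}
    (h : N.IsLegal w (y, q)) (hx : 0 ≤ x) : N.IsLegal w (x + y, q) := by
  induction w generalizing y q with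
  | nil => trivial
  | cons a w ih =>
    refine ⟨?_, ?_⟩
    · have := h.1
      have := hx a
      simp only [Pi.add_apply, Pi.zero_apply] at *
      omega
    · rw [step_add]
      exact ih h.2

theorem IsLegal.exec_nonneg {w : List (Σ v, A v)} {c : ((Σ v, A v) → ℤ) × (∀ v, Q v)}
    (h : N.IsLegal w c) (hc : 0 ≤ c.1) : 0 ≤ (N.exec w c).1 := by
  induction w generalizing c with
  | nil => exact hc
  | cons a w ih =>
    refine ih h.2 fun b => ?_
    have h₁ := h.1
    have h₂ := hc b
    simp only [step, Pi.zero_apply] at *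
    split_ifs with hb
    · subst hb; omega
    · omega

theorem isLegal_of_count_le {w : List (Σ v, A v)} {x : (Σ v, A v) → ℤ} {q : ∀ v, Q v}
    (h : ∀ a, (w.count a : ℤ) ≤ x a) : N.IsLegal w (x, q) := by
  induction w generalizing x q with
  | nil => trivial
  | cons a w ih =>
    refine ⟨?_, ih fun b => ?_⟩
    · have := h a
      simp only [List.count_cons_self, Nat.cast_add, Nat.cast_one] at this ⊢
      omega
    · have := h b
      rw [List.count_cons] at this
      by_cases hb : b = a
      · subst hb
        simp at this ⊢
        omega
      · simp [hb, Ne.symm hb] at this ⊢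
        omega

/-- The least action principle: a legal execution is contained in every complete execution. -/
theorem IsLegal.subperm {w w' : List (Σ v, A v)} {c : ((Σ v, A v) → ℤ) × (∀ v, Q v)}
    (h : N.IsLegal w c) (h' : N.IsComplete w' c) : w.Subperm w' := by
  induction w generalizing w' c with
  | nil => exact List.nil_subperm
  | cons a w ih =>
    have ha : a ∈ w' := by
      by_contra ha
      obtain ⟨x, q⟩ := c
      have h₁ := h' a
      have h₂ := h.1
      rw [exec_eq] at h₁
      simp only [List.count_eq_zero_of_not_mem ha] at h₁ h₂
      omega
    have hp := List.perm_cons_erase ha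
    have hcomp : N.IsComplete (w'.erase a) (N.step c a) := by
      intro b
      have := h' b
      rw [N.exec_perm hp] at this
      exact this
    exact ((List.subperm_cons a).2 (ih h.2 hcomp)).trans hp.symm.subperm

/-- By least action, two complete legal executions contain each other, so they are permutations and
end in the same state. -/
theorem globalAct_eq_of_isComplete {w : List (Σ v, A v)} {x : (Σ v, A v) → ℤ} {q : ∀ v, Q v}
    (h : N.IsLegal w (x, q)) (h' : N.IsComplete w (x, q)) :
    N.globalAct x q = (N.exec w (x, q)).2 := by
  have hx : N.HaltsOn x q := ⟨w, h, h'⟩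
  obtain ⟨h₁, h₂⟩ := hx.choose_spec
  rw [globalAct, dif_pos hx, N.exec_perm ((h₁.subperm h').antisymm (h.subperm h₂))]

/-- A legal execution does not change the final state. -/
theorem globalAct_exec (hhalt : N.HaltsOnAllInputs) {w : List (Σ v, A v)} {x : (Σ v, A v) → ℤ} {q : ∀ v, Q v}
    (hx : 0 ≤ x) (h : N.IsLegal w (x, q)) :
    N.globalAct (N.exec w (x, q)).1 (N.exec w (x, q)).2 = N.globalAct x q := by
  obtain ⟨w', h₁, h₂⟩ := hhalt _ (N.exec w (x, q)).2 (h.exec_nonneg hx)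
  rw [globalAct_eq_of_isComplete h₁ h₂,
    globalAct_eq_of_isComplete (w := w ++ w') (N.isLegal_append.2 ⟨h, h₁⟩), exec_append]
  intro a
  rw [exec_append]
  exact h₂ a

/-- The letters `y` can be processed to completion while the letters `x` wait. -/
theorem globalAct_add (hhalt : N.HaltsOnAllInputs) {x y : (Σ v, A v) → ℤ} (hx : 0 ≤ x)
    (hy : 0 ≤ y) (q : ∀ v, Q v) :
    N.globalAct (x + y) q = N.globalAct x (N.globalAct y q) := by
  obtain ⟨w, h₁, h₂⟩ := hhalt y q hy
  -- Completeness only gives counts `≤ 0`; legality from a nonnegative input makes them exactly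
  -- zero.
  have h0 : (N.exec w (y, q)).1 = 0 := le_antisymm h₂ (h₁.exec_nonneg hy)
  rw [globalAct_eq_of_isComplete h₁ h₂, ← globalAct_exec hhalt (add_nonneg hx hy) (h₁.add hx),
    exec_add, h0, add_zero]

theorem globalAct_zero (q : ∀ v, Q v) : N.globalAct 0 q = q :=
  globalAct_eq_of_isComplete (w := []) trivial fun _ => le_rfl

theorem runWord_globalAct (hhalt : N.HaltsOnAllInputs) (w : List (Σ v, A v)) (q : ∀ v, Q v) :
    runWord (fun a q => N.globalAct (Pi.single a 1) q) w q =
      N.globalAct (fun a => (w.count a : ℤ)) q := by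
  induction w generalizing q with
  | nil => exact (globalAct_zero q).symm
  | cons a w ih =>
    rw [runWord, ih, ← globalAct_add hhalt (fun _ => by simp) (Pi.single_nonneg.2 zero_le_one)]
    congr 1
    funext b
    by_cases hb : b = a
    · subst hb; simp
    · simp [hb, Ne.symm hb]

theorem globalAct_single_comm (hhalt : N.HaltsOnAllInputs) (a b : Σ v, A v) (q : ∀ v, Q v) :
    N.globalAct (Pi.single a 1) (N.globalAct (Pi.single b 1) q) =
      N.globalAct (Pi.single b 1) (N.globalAct (Pi.single a 1) q) := by
  rw [← globalAct_add hhalt (Pi.single_nonneg.2 zero_le_one) (Pi.single_nonneg.2 zero_le_one),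
    add_comm, globalAct_add hhalt (Pi.single_nonneg.2 zero_le_one) (Pi.single_nonneg.2 zero_le_one)]

end AbelianNetwork

theorem exists_word_count_eq {I : Type*} [Fintype I] [DecidableEq I] (y : I → ℕ) :
    ∃ w : List I, ∀ a, w.count a = y a := by
  refine ⟨(Finsupp.toMultiset (Finsupp.equivFunOnFinite.symm y)).toList, fun a => ?_⟩
  rw [← Multiset.coe_count, Multiset.coe_toList, Finsupp.count_toMultiset]
  rfl

/-- The chips lost by each letter when every letter `a` topples `z a` times. -/
def TopplingNetwork.loss {A : Type*} [Fintype A] (S : TopplingNetwork A) (z : A → ℤ) (b : A) : ℤ :=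
  S.threshold b * z b - ∑ a, S.send a b * z a

/-! ### Local recurrence, reset numbers and the Laplacian -/

namespace AbelianNetwork

variable {V : Type*} {G : Digraph V} {A Q : V → Type*} {N : AbelianNetwork G A Q}
variable [∀ v, Finite (Q v)]

theorem runWord_next_mem [DecidableEq V] {q : ∀ v, Q v} {v : V}
    (h : q v ∈ recurrentStates (N.proc v).t) (w : List (Σ v, A v)) :
    runWord N.next w q v ∈ recurrentStates (N.proc v).t := by
  induction w generalizing q with
  | nil => exact h
  | cons a w ih =>
    refine ih ?_
    obtain ⟨u, a⟩ := a
    by_cases hv : v = u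
    · subst hv
      rw [next, Function.update_self]
      exact runWord_mem_recurrentStates (N.proc v).t_comm [a] h
    · rwa [next, Function.update_of_ne hv]

theorem IsLocallyRecurrent.runWord_next [DecidableEq V] {q : ∀ v, Q v}
    (h : N.IsLocallyRecurrent q) (w : List (Σ v, A v)) :
    N.IsLocallyRecurrent (runWord N.next w q) :=
  fun v => runWord_next_mem (h v) w

omit [∀ v, Finite (Q v)] in
theorem runWord_next_map [DecidableEq V] (v : V) (w : List (A v)) (q : ∀ v, Q v) :
    runWord N.next (w.map (Sigma.mk v)) q =
      Function.update q v (runWord (N.proc v).t w (q v)) := by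
  induction w generalizing q with
  | nil => simp [runWord]
  | cons a w ih =>
    rw [List.map_cons, runWord, ih]
    simp [next, runWord]

/-- Concatenates, over all vertices, words acting as the local minimal idempotents. One word serves
all states. -/
theorem exists_word_isLocallyRecurrent [DecidableEq V] [Fintype V] (N : AbelianNetwork G A Q) :
    ∃ w, ∀ q, N.IsLocallyRecurrent (runWord N.next w q) := by
  choose w₀ _ hw₀ _ using fun v => exists_minimal_word (N.proc v).t_comm
  have key : ∀ (l : List V) (q : ∀ v, Q v), ∀ v ∈ l,
      runWord N.next (l.flatMap fun v => (w₀ v).map (Sigma.mk v)) q v ∈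
        recurrentStates (N.proc v).t := by
    intro l
    induction l with
    | nil => simp
    | cons u l ih =>
      intro q v hv
      rw [List.flatMap_cons, runWord_append]
      rcases List.mem_cons.1 hv with rfl | hv
      · refine runWord_next_mem ?_ _
        rw [runWord_next_map, Function.update_self]
        exact hw₀ v _
      · exact ih _ v hv
  exact ⟨_, fun q v => key Finset.univ.toList q v (by simp)⟩

theorem exists_isLocallyRecurrent (hirr : N.IsIrreducible) : ∃ q, N.IsLocallyRecurrent q := by
  choose w₀ _ hw₀ _ using fun v => exists_minimal_word (N.proc v).t_comm
  exact ⟨fun v => runWord (N.proc v).t (w₀ v) (hirr v).1.some, fun v => hw₀ v _⟩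

variable [DecidableEq V] [∀ v, DecidableEq (A v)]

omit [∀ v, Finite (Q v)] in
theorem single_mem_totalKernel_iff (v : V) (a : A v) (m : ℤ) :
    Pi.single (⟨v, a⟩ : Σ v, A v) m ∈ N.totalKernel ↔ Pi.single a m ∈ (N.proc v).kernel := by
  have h₁ : (fun b : A v => (Pi.single (⟨v, a⟩ : Σ v, A v) m : (Σ v, A v) → ℤ) ⟨v, b⟩) =
      Pi.single a m := by
    funext b
    by_cases hb : b = a
    · subst hb; simp
    · rw [Pi.single_eq_of_ne hb, Pi.single_eq_of_ne (by simpa using hb)]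
  constructor
  · intro h
    rw [← h₁]
    exact h v
  · intro h u
    by_cases hu : u = v
    · subst hu
      rwa [h₁]
    · convert (N.proc u).zero_mem_kernel using 1
      funext b
      exact Pi.single_eq_of_ne (fun h => hu (congrArg Sigma.fst h)) _

/-- Each letter has finite order on recurrent states, so the infimum is attained and is not the
default value `0`. -/
theorem resetNumber_mem (N : AbelianNetwork G A Q) (a : Σ v, A v) :
    N.resetNumber a ∈ {m : ℕ | 1 ≤ m ∧ Pi.single a (m : ℤ) ∈ N.totalKernel} := by
  refine Nat.sInf_mem ?_
  obtain ⟨v, a⟩ := a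
  obtain ⟨m, hm, h⟩ := exists_runWord_replicate_eq (N.proc v).t_comm a
  exact ⟨m, hm, (single_mem_totalKernel_iff v a m).2 (((N.proc v).single_mem_kernel_iff a m).2 h)⟩

theorem one_le_resetNumber (N : AbelianNetwork G A Q) (a : Σ v, A v) : 1 ≤ N.resetNumber a :=
  (N.resetNumber_mem a).1

theorem IsLocallyRecurrent.runWord_replicate {q : ∀ v, Q v} (h : N.IsLocallyRecurrent q)
    (a : Σ v, A v) : runWord N.next (List.replicate (N.resetNumber a) a) q = q := by
  have h₁ := (N.resetNumber_mem a).2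
  obtain ⟨v, a⟩ := a
  rw [single_mem_totalKernel_iff, AbelianProcessor.single_mem_kernel_iff] at h₁
  rw [← List.map_replicate (f := Sigma.mk v), runWord_next_map, h₁ _ (h v), Function.update_eq_self]

omit [∀ v, Finite (Q v)] in
theorem sentByWord_replicate_congr (a : Σ v, A v) (m : ℕ) {q q' : ∀ v, Q v}
    (h : q a.1 = q' a.1) :
    N.sentByWord (List.replicate m a) q = N.sentByWord (List.replicate m a) q' := by
  induction m generalizing q q' with
  | zero => rfl
  | succ m ih =>
    rw [List.replicate_succ, sentByWord, sentByWord, N.sent_congr h, ih]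
    simp [next, h]

/-- Irreducibility gives a word of `a`'s processor leading from the chosen recurrent state to the
given one. The block of `r_a` letters is a loop at the chosen state, so the exchange identity
cancels the output of the connecting word. -/
theorem IsLocallyRecurrent.sentByWord_replicate (hirr : N.IsIrreducible) {q : ∀ v, Q v}
    (h : N.IsLocallyRecurrent q) (a b : Σ v, A v) :
    N.sentByWord (List.replicate (N.resetNumber a) a) q b = N.resetProduction a b := by
  have hex : ∃ q, N.IsLocallyRecurrent q := ⟨q, h⟩
  rw [resetProduction, dif_pos hex]
  obtain ⟨w, hw⟩ := exists_runWord_eq_of_irreducible (N.proc a.1).t_comm (hirr a.1)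
    (hex.choose a.1) (h a.1)
  have h₁ := N.sentByWord_append_comm (List.replicate (N.resetNumber a) a)
    (w.map (Sigma.mk a.1)) hex.choose
  rw [hex.choose_spec.runWord_replicate, add_comm] at h₁
  have h₂ := add_left_cancel h₁
  rw [h₂]
  refine congrFun (sentByWord_replicate_congr a _ ?_) b
  rw [runWord_next_map, Function.update_self, hw]

variable [Fintype V] [∀ v, Fintype (A v)]

/-- The effect of processing a word whose letter counts are multiples of the reset numbers. -/
theorem IsLocallyRecurrent.runWord_of_count (hirr : N.IsIrreducible) {q : ∀ v, Q v}
    (h : N.IsLocallyRecurrent q) {w : List (Σ v, A v)} {y : (Σ v, A v) → ℤ}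
    (hw : ∀ a, (w.count a : ℤ) = N.resetNumber a * y a) :
    runWord N.next w q = q ∧
      ∀ b, (N.sentByWord w q b : ℤ) = ∑ a, (N.resetProduction a b : ℤ) * y a := by
  obtain ⟨l, hl⟩ := exists_word_count_eq fun a => (y a).toNat
  have hy : ∀ a, ((y a).toNat : ℤ) = y a := fun a => Int.toNat_of_nonneg (by
    have h₁ := hw a
    have h₂ := N.one_le_resetNumber a
    by_contra! hlt
    have : (N.resetNumber a : ℤ) * y a < 0 := mul_neg_of_pos_of_neg (by exact_mod_cast h₂) hlt
    omega)
  -- `w` is a permutation of a concatenation of blocks of `r_a` letters `a`, each of which fixes `q`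
  -- and sends a column of `P D`.
  have hblock : ∀ l : List (Σ v, A v),
      (∀ b, (l.flatMap fun a => List.replicate (N.resetNumber a) a).count b =
        N.resetNumber b * l.count b) ∧
      runWord N.next (l.flatMap fun a => List.replicate (N.resetNumber a) a) q = q ∧
      ∀ b, N.sentByWord (l.flatMap fun a => List.replicate (N.resetNumber a) a) q b =
        ∑ a, N.resetProduction a b * l.count a := by
    intro l
    induction l with
    | nil => simp [runWord, sentByWord]
    | cons c l ih =>
      obtain ⟨ih₁, ih₂, ih₃⟩ := ih
      refine ⟨fun b => ?_, ?_, fun b => ?_⟩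
      · rw [List.flatMap_cons, List.count_append, ih₁, List.count_replicate, List.count_cons]
        by_cases hb : c = b
        · subst hb; simp; ring
        · simp [hb]
      · rw [List.flatMap_cons, runWord_append, h.runWord_replicate, ih₂]
      · rw [List.flatMap_cons, sentByWord_append, h.runWord_replicate, Pi.add_apply, ih₃,
          h.sentByWord_replicate hirr]
        simp [List.count_cons, mul_add, Finset.sum_add_distrib, add_comm]
  obtain ⟨h₁, h₂, h₃⟩ := hblock l
  have hperm : w.Perm (l.flatMap fun a => List.replicate (N.resetNumber a) a) := by
    refine List.perm_iff_count.2 fun a => ?_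
    have := hw a
    rw [h₁, hl]
    rw [← hy a] at this
    exact_mod_cast this
  refine ⟨by rw [runWord_perm N.next_comm hperm, h₂], fun b => ?_⟩
  rw [N.sentByWord_perm hperm, h₃]
  push_cast
  simp only [hl, hy]

theorem IsLocallyRecurrent.exec_of_count (hirr : N.IsIrreducible) {q : ∀ v, Q v}
    (h : N.IsLocallyRecurrent q) {w : List (Σ v, A v)} {y : (Σ v, A v) → ℤ}
    (hw : ∀ a, (w.count a : ℤ) = N.resetNumber a * y a) (x : (Σ v, A v) → ℤ) :
    N.exec w (x, q) = (x - N.sandpilization.loss y, q) := by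
  obtain ⟨h₁, h₂⟩ := h.runWord_of_count hirr hw
  rw [exec_eq, h₁]
  refine Prod.ext (funext fun b => ?_) rfl
  simp only [h₂, hw, Pi.sub_apply, TopplingNetwork.loss, sandpilization]
  ring

omit [∀ v, Finite (Q v)] in
theorem exists_word_count_eq_resetNumber_mul (N : AbelianNetwork G A Q) {y : (Σ v, A v) → ℤ}
    (hy : 0 ≤ y) :
    ∃ w : List (Σ v, A v), ∀ a, (w.count a : ℤ) = N.resetNumber a * y a := by
  obtain ⟨w, hw⟩ := exists_word_count_eq fun a => N.resetNumber a * (y a).toNat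
  refine ⟨w, fun a => ?_⟩
  rw [hw, Nat.cast_mul, Int.toNat_of_nonneg (hy a)]

/-- A halting network has no nonzero execution that reproduces all of its letters. -/
theorem eq_zero_of_loss_nonpos (hirr : N.IsIrreducible) (hhalt : N.HaltsOnAllInputs)
    {y : (Σ v, A v) → ℤ} (hy : 0 ≤ y) (hloss : ∀ b, N.sandpilization.loss y b ≤ 0) : y = 0 := by
  by_contra hne
  obtain ⟨a, ha⟩ := Function.ne_iff.1 hne
  obtain ⟨w, hw⟩ := N.exists_word_count_eq_resetNumber_mul hy
  obtain ⟨q, hq⟩ := exists_isLocallyRecurrent hirr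
  have hpos : 1 ≤ w.length := by
    have h₁ : 1 ≤ y a := lt_of_le_of_ne (hy a) (Ne.symm ha)
    have h₂ := one_le_resetNumber N a
    have h₃ := hw a
    have h₄ := List.count_le_length (l := w) (a := a)
    have : 1 * 1 ≤ (N.resetNumber a : ℤ) * y a :=
      mul_le_mul (by exact_mod_cast h₂) h₁ (by norm_num) (by positivity)
    omega
  -- Running `w` returns to `q` with no fewer letters, so it can be repeated; arbitrarily long legal
  -- executions contradict least action.
  have key : ∀ (n : ℕ) (x : (Σ v, A v) → ℤ), (∀ a, (w.count a : ℤ) ≤ x a) →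
      ∃ u, N.IsLegal u (x, q) ∧ n ≤ u.length := by
    intro n
    induction n with
    | zero => exact fun x _ => ⟨[], trivial, le_rfl⟩
    | succ n ih =>
      intro x hx
      obtain ⟨u, hu, hn⟩ := ih (x - N.sandpilization.loss y) fun a =>
        (hx a).trans (by have := hloss a; simp only [Pi.sub_apply]; omega)
      refine ⟨w ++ u, N.isLegal_append.2 ⟨isLegal_of_count_le hx, ?_⟩, ?_⟩
      · rwa [hq.exec_of_count hirr hw]
      · rw [List.length_append]; omega
  obtain ⟨w', -, hw'⟩ := hhalt (fun a => (w.count a : ℤ)) q fun a => by simp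
  obtain ⟨u, hu, hlen⟩ := key (w'.length + 1) _ fun a => le_rfl
  have := (hu.subperm hw').length_le
  omega

end AbelianNetwork

/-! ### Burning elements and existence of an odometer -/

namespace AbelianNetwork

variable {V : Type*} {G : Digraph V} {A Q : V → Type*} {N : AbelianNetwork G A Q}
variable [∀ v, Finite (Q v)] [DecidableEq V] [∀ v, DecidableEq (A v)]
variable [Fintype V] [∀ v, Fintype (A v)]

omit [∀ v, DecidableEq (A v)] [∀ v, Fintype (A v)] [DecidableEq V] in
theorem exists_forall_state_le (f : (∀ v, Q v) → ℕ) : ∃ C, ∀ q, f q ≤ C := by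
  obtain ⟨C, hC⟩ := (Set.finite_range f).bddAbove
  exact ⟨C, fun q => hC ⟨q, rfl⟩⟩

/-- From a locally recurrent state, `n + C` blocks of `r_a` letters send at least `n + C` letters
`b`. Moving the preparatory word `w` from before the blocks to after them costs at most `C`, which
bounds the output of `w` from every state. -/
theorem exists_le_sentByWord_replicate (hirr : N.IsIrreducible) {a b : Σ v, A v}
    (hab : N.resetProduction a b ≠ 0) (n : ℕ) :
    ∃ M, ∀ q, n ≤ N.sentByWord (List.replicate M a) q b := by
  obtain ⟨w, hw⟩ := N.exists_word_isLocallyRecurrent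
  obtain ⟨C, hC⟩ := exists_forall_state_le fun q => N.sentByWord w q b
  refine ⟨N.resetNumber a * (n + C), fun q => ?_⟩
  have h₁ := congrFun (N.sentByWord_append_comm
    (List.replicate (N.resetNumber a * (n + C)) a) w q) b
  have h₂ := ((hw q).runWord_of_count hirr (w := List.replicate (N.resetNumber a * (n + C)) a)
    (y := Pi.single a ((n + C : ℕ) : ℤ)) (fun c => by
      by_cases hc : c = a
      · subst hc; simp
      · simp [List.count_replicate, hc, Ne.symm hc])).2 b
  have h₃ := hC (runWord N.next (List.replicate (N.resetNumber a * (n + C)) a) q)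
  simp only [Pi.add_apply] at h₁
  simp only [Pi.single_apply, mul_ite, mul_zero, Finset.sum_ite_eq', Finset.mem_univ,
    if_true] at h₂
  have h₄ : N.resetProduction a b * (n + C) =
    N.sentByWord (List.replicate (N.resetNumber a * (n + C)) a) (runWord N.next w q) b := by
    exact_mod_cast h₂.symm
  have h₅ : 1 * (n + C) ≤ N.resetProduction a b * (n + C) :=
    Nat.mul_le_mul_right _ (Nat.one_le_iff_ne_zero.2 hab)
  omega

variable (N) in
/-- Arbitrarily many letters `a` can be produced legally from multiples of `β`, in any state. -/
def IsAbundant (β : (Σ v, A v) → ℤ) (a : Σ v, A v) : Prop :=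
  ∀ (n : ℕ) (q : ∀ v, Q v), ∃ (l : ℕ) (u : List (Σ v, A v)),
    N.IsLegal u (l • β, q) ∧ (n : ℤ) ≤ (N.exec u (l • β, q)).1 a

omit [∀ v, Finite (Q v)] [Fintype V] [∀ v, Fintype (A v)] in
theorem isAbundant_of_pos {β : (Σ v, A v) → ℤ} {a : Σ v, A v} (ha : 0 < β a) :
    N.IsAbundant β a := by
  refine fun n q => ⟨n, [], trivial, ?_⟩
  change (n : ℤ) ≤ n • β a
  rw [nsmul_eq_mul]
  nlinarith

theorem IsAbundant.of_resetProduction (hirr : N.IsIrreducible) {β : (Σ v, A v) → ℤ} (hβ : 0 ≤ β)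
    {a b : Σ v, A v} (ha : N.IsAbundant β a) (hab : N.resetProduction a b ≠ 0) :
    N.IsAbundant β b := by
  intro n q
  obtain ⟨M, hM⟩ := exists_le_sentByWord_replicate hirr hab n
  obtain ⟨l, u, hu, hl⟩ := ha M q
  have hnn := hu.exec_nonneg (nsmul_nonneg hβ l)
  have hleg : N.IsLegal (List.replicate M a) (N.exec u (l • β, q)) := by
    refine isLegal_of_count_le fun c => ?_
    rw [List.count_replicate]
    split_ifs with hc
    · rwa [← eq_of_beq hc]
    · exact hnn c
  refine ⟨l, u ++ List.replicate M a, N.isLegal_append.2 ⟨hu, hleg⟩, ?_⟩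
  have hM' := hM (N.exec u (l • β, q)).2
  rw [exec_append]
  generalize N.exec u (l • β, q) = c at *
  obtain ⟨x, q'⟩ := c
  rw [exec_eq]
  simp only [List.count_replicate] at *
  have : (0 : ℤ) ≤ x b := hnn b
  split_ifs with hc
  · rw [eq_of_beq hc] at hl
    omega
  · push_cast
    omega

/-- Abundance passes along `resetProduction`, so abundant letters send nothing to the others, on
which `β ≤ 0`. Restricting `y` to the non-abundant letters thus gives a vector with nonpositive
loss, which halting forces to vanish. -/
theorem isAbundant_loss (hirr : N.IsIrreducible) (hhalt : N.HaltsOnAllInputs)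
    {y : (Σ v, A v) → ℤ} (hy : 1 ≤ y) (hloss : 0 ≤ N.sandpilization.loss y) (a : Σ v, A v) :
    N.IsAbundant (N.sandpilization.loss y) a := by
  classical
  set β := N.sandpilization.loss y
  have hzero := eq_zero_of_loss_nonpos (N := N) hirr hhalt
    (y := fun a => if N.IsAbundant β a then 0 else y a)
    (fun a => by
      have : (1 : ℤ) ≤ y a := hy a
      simp only [Pi.zero_apply]
      split_ifs <;> omega) (fun b => by
      by_cases hb : N.IsAbundant β b
      · simp only [TopplingNetwork.loss, hb, if_true, mul_zero, zero_sub, neg_nonpos]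
        refine Finset.sum_nonneg fun c _ => mul_nonneg (by positivity) ?_
        have : (1 : ℤ) ≤ y c := hy c
        split_ifs <;> omega
      · have hβb : β b ≤ 0 := not_lt.1 fun h => hb (isAbundant_of_pos h)
        refine le_of_eq_of_le ?_ hβb
        change _ = N.sandpilization.loss y b
        simp only [TopplingNetwork.loss, hb, if_false]
        congr 1
        refine Finset.sum_congr rfl fun c _ => ?_
        split_ifs with hc
        · have : N.resetProduction c b = 0 := by
            by_contra h
            exact hb (hc.of_resetProduction hirr hloss h)
          simp [sandpilization, this]
        · rfl)
  have h := congrFun hzero a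
  by_contra ha
  simp only [ha, if_false, Pi.zero_apply] at h
  have : (1 : ℤ) ≤ y a := hy a
  omega

omit [∀ v, Finite (Q v)] in
theorem exists_isLegal_le {β : (Σ v, A v) → ℤ} (hβ : 0 ≤ β) (h : ∀ a, N.IsAbundant β a)
    (z : (Σ v, A v) → ℕ) (q : ∀ v, Q v) : ∃ (l : ℕ) (u : List (Σ v, A v)),
      N.IsLegal u (l • β, q) ∧ ∀ a, (z a : ℤ) ≤ (N.exec u (l • β, q)).1 a := by
  have key : ∀ s : Finset (Σ v, A v), ∃ (l : ℕ) (u : List (Σ v, A v)),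
      N.IsLegal u (l • β, q) ∧ ∀ a ∈ s, (z a : ℤ) ≤ (N.exec u (l • β, q)).1 a := by
    intro s
    induction s using Finset.induction_on with
    | empty => exact ⟨0, [], trivial, by simp⟩
    | insert a s _ ih =>
      obtain ⟨l₁, u₁, hu₁, hs⟩ := ih
      -- The second execution starts in the state left by the first; this is why abundance is
      -- required in every state.
      obtain ⟨l₂, u₂, hu₂, ha⟩ := h a (z a) (N.exec u₁ (l₁ • β, q)).2
      have hn₁ := hu₁.exec_nonneg (nsmul_nonneg hβ l₁)
      have hn₂ := hu₂.exec_nonneg (nsmul_nonneg hβ l₂)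
      have hexec : N.exec u₁ ((l₁ + l₂) • β, q) =
          ((N.exec u₁ (l₁ • β, q)).1 + l₂ • β, (N.exec u₁ (l₁ • β, q)).2) := by
        rw [add_comm l₁, add_smul, exec_add, add_comm]
      refine ⟨l₁ + l₂, u₁ ++ u₂, N.isLegal_append.2 ⟨?_, ?_⟩, fun b hb => ?_⟩
      · rw [add_comm, add_smul]
        exact hu₁.add (nsmul_nonneg hβ l₂)
      · rw [hexec]
        exact hu₂.add hn₁
      · rw [exec_append, hexec, exec_add]
        have h₁ := hn₁ b
        have h₂ := hn₂ b
        simp only [Pi.add_apply, Pi.zero_apply] at h₁ h₂ ⊢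
        rcases Finset.mem_insert.1 hb with rfl | hb
        · omega
        · have := hs b hb
          omega
  obtain ⟨l, u, hu, hz⟩ := key Finset.univ
  exact ⟨l, u, hu, fun a => hz a (Finset.mem_univ a)⟩

omit [∀ v, Finite (Q v)] [Fintype V] [∀ v, Fintype (A v)] in
theorem globalAct_nsmul (hhalt : N.HaltsOnAllInputs) {β : (Σ v, A v) → ℤ} (hβ : 0 ≤ β)
    {q : ∀ v, Q v} (hq : N.globalAct β q = q) (n : ℕ) : N.globalAct (n • β) q = q := by
  induction n with
  | zero => rw [zero_smul, globalAct_zero]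
  | succ n ih => rw [succ_nsmul, globalAct_add hhalt (nsmul_nonneg hβ n) hβ, hq, ih]

theorem globalAct_mem_recStates (hhalt : N.HaltsOnAllInputs) {x : (Σ v, A v) → ℤ} (hx : 0 ≤ x)
    {q : ∀ v, Q v} (hq : q ∈ N.recStates) : N.globalAct x q ∈ N.recStates := by
  obtain ⟨w, hw⟩ := exists_word_count_eq fun a => (x a).toNat
  have h := runWord_mem_recurrentStates (globalAct_single_comm hhalt) w hq
  have hwx : (fun a => (w.count a : ℤ)) = x :=
    funext fun a => by rw [hw, Int.toNat_of_nonneg (hx a)]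
  rwa [runWord_globalAct hhalt, hwx] at h

theorem globalAct_injOn_recStates (hhalt : N.HaltsOnAllInputs) {x : (Σ v, A v) → ℤ}
    (hx : 0 ≤ x) : Set.InjOn (N.globalAct x) N.recStates := by
  obtain ⟨w, hw⟩ := exists_word_count_eq fun a => (x a).toNat
  have h := runWord_injOn_recurrentStates (globalAct_single_comm hhalt) w
  have hwx : (fun a => (w.count a : ℤ)) = x :=
    funext fun a => by rw [hw, Int.toNat_of_nonneg (hx a)]
  rwa [funext (runWord_globalAct hhalt w), hwx] at h

omit [∀ v, Fintype (A v)] in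
-- A recurrent state results from feeding in the letters of `w` last. Executing `w` itself first
-- makes the state locally recurrent, and the rest of the execution keeps it so.
theorem isLocallyRecurrent_of_mem_recStates (hhalt : N.HaltsOnAllInputs) {q : ∀ v, Q v}
    (hq : q ∈ N.recStates) : N.IsLocallyRecurrent q := by
  obtain ⟨w, hw⟩ := N.exists_word_isLocallyRecurrent
  obtain ⟨w₀, hw₀, -, hmin⟩ := exists_minimal_word (globalAct_single_comm hhalt)
  obtain ⟨w', hw'⟩ := hmin w
  have h := (hw₀ q).1 hq
  rw [← hw', runWord_comm (globalAct_single_comm hhalt), runWord_globalAct hhalt] at h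
  have hx : (0 : (Σ v, A v) → ℤ) ≤ fun a => (w.count a : ℤ) := fun a => by simp
  generalize runWord _ w' q = q' at h
  have hleg : N.IsLegal w (fun a => (w.count a : ℤ), q') := isLegal_of_count_le fun _ => le_rfl
  rw [← globalAct_exec hhalt hx hleg] at h
  obtain ⟨u, hu, hu'⟩ := hhalt _ (N.exec w (fun a => (w.count a : ℤ), q')).2
    (hleg.exec_nonneg hx)
  rw [globalAct_eq_of_isComplete hu hu', exec_eq, exec_eq] at h
  rw [← h]
  exact (hw q').runWord_next u

theorem isBurningElement_loss (hirr : N.IsIrreducible) (hhalt : N.HaltsOnAllInputs)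
    {y : (Σ v, A v) → ℤ} (hy : 1 ≤ y) (hloss : 0 ≤ N.sandpilization.loss y) :
    N.IsBurningElement (N.sandpilization.loss y) := by
  have hy0 : 0 ≤ y := fun a => (zero_le_one' ℤ).trans (hy a)
  refine ⟨hloss, fun q => ⟨fun hq => ?_, fun hq => ?_⟩⟩
  · have hloc := isLocallyRecurrent_of_mem_recStates hhalt hq
    obtain ⟨w, hw⟩ := N.exists_word_count_eq_resetNumber_mul hy0
    have hx : (0 : (Σ v, A v) → ℤ) ≤ fun a => (w.count a : ℤ) := fun a => by simp
    have hleg : N.IsLegal w (fun a => (w.count a : ℤ), q) := isLegal_of_count_le fun _ => le_rfl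
    have h₁ := globalAct_exec hhalt hx hleg
    have h₂ := hleg.exec_nonneg hx
    rw [hloc.exec_of_count hirr hw] at h₁ h₂
    -- With `x = D y`, both `x` and `x - β` act on `q` in the same way; cancel `x - β`.
    refine globalAct_injOn_recStates hhalt h₂ (globalAct_mem_recStates hhalt hloss hq) hq ?_
    rw [← globalAct_add hhalt h₂ hloss]
    simpa using h₁.symm
  · obtain ⟨w₀, -, hw₀, -⟩ := exists_minimal_word (globalAct_single_comm hhalt)
    -- A multiple of `β`, which fixes `q`, legally yields all letters of the idempotent word `w₀`.
    -- Processing these last exhibits `q` as an image of the idempotent.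
    obtain ⟨l, u, hu, hle⟩ := exists_isLegal_le hloss (isAbundant_loss hirr hhalt hy hloss)
      (fun a => w₀.count a) q
    have h₁ := globalAct_exec hhalt (nsmul_nonneg hloss l) hu
    rw [globalAct_nsmul hhalt hloss hq] at h₁
    generalize N.exec u _ = c at h₁ hle
    have h₂ := hw₀ (N.globalAct (c.1 - fun a => (w₀.count a : ℤ)) c.2)
    have h₃ : (0 : (Σ v, A v) → ℤ) ≤ fun a => (w₀.count a : ℤ) := fun a => by simp
    have h₄ : 0 ≤ c.1 - fun a => (w₀.count a : ℤ) := sub_nonneg.2 hle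
    rwa [runWord_globalAct hhalt, ← globalAct_add hhalt h₃ h₄, add_sub_cancel, h₁] at h₂

theorem exists_one_le_loss_nonneg (hirr : N.IsIrreducible) (hhalt : N.HaltsOnAllInputs) :
    ∃ y, 1 ≤ y ∧ 0 ≤ N.sandpilization.loss y := by
  obtain ⟨q, hq⟩ := exists_isLocallyRecurrent hirr
  choose word hword using fun c : (Σ v, A v) → ℕ => exists_word_count_eq c
  -- `C b` bounds the letters `b` sent by any padding word, with fewer than `r_a` letters `a`, from
  -- any state.
  have hbound : ∀ b, ∃ C : ℕ, ∀ p : (∀ a, Fin (N.resetNumber a)) × (∀ v, Q v),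
      N.sentByWord (word fun a => (p.1 a : ℕ)) p.2 b ≤ C := fun b => by
    obtain ⟨C, hC⟩ := (Set.finite_range fun p : (∀ a, Fin (N.resetNumber a)) × (∀ v, Q v) =>
      N.sentByWord (word fun a => (p.1 a : ℕ)) p.2 b).bddAbove
    exact ⟨C, fun p => hC ⟨p, rfl⟩⟩
  choose C hC using hbound
  -- The extra `1` forces every letter to be processed at least once, which gives `y ≥ 1`.
  obtain ⟨w, hleg, hcomp⟩ := hhalt (fun a => (C a : ℤ) + 1) q fun a => by simp; positivity
  have hr := N.one_le_resetNumber
  have hpad : ∀ a, ∃ d : Fin (N.resetNumber a), N.resetNumber a ∣ w.count a + d := by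
    intro a
    have hlt : w.count a * (N.resetNumber a - 1) % N.resetNumber a < N.resetNumber a :=
      Nat.mod_lt _ (hr a)
    -- The padding is congruent to `-(w.count a)` modulo `r_a`.
    refine ⟨⟨_, hlt⟩, ?_⟩
    rw [Nat.dvd_iff_mod_eq_zero, Nat.add_mod_mod]
    obtain ⟨s, hs⟩ := Nat.exists_eq_add_of_le (hr a)
    rw [hs, Nat.add_sub_cancel_left, ← mul_one_add, Nat.mul_mod_left]
  choose d hd using hpad
  choose y hy using hd
  have hcount : ∀ a, (((w ++ word fun a => (d a : ℕ)).count a : ℕ) : ℤ) =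
      N.resetNumber a * (y a : ℤ) := fun a => by
    rw [List.count_append, hword]
    exact_mod_cast hy a
  have hexec := hq.exec_of_count hirr hcount (fun a => (C a : ℤ) + 1)
  have h0 := le_antisymm hcomp (hleg.exec_nonneg fun a => by simp; positivity)
  have hw1 : ∀ a, 1 ≤ w.count a := fun a => by
    have h := congrFun h0 a
    rw [exec_eq] at h
    simp only [Pi.zero_apply] at h
    omega
  refine ⟨fun a => (y a : ℤ), fun a => ?_, fun b => ?_⟩
  · have h₁ := hw1 a
    have h₂ := hy a
    have : y a ≠ 0 := fun h => by rw [h, mul_zero] at h₂; omega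
    simp only [Pi.one_apply]
    omega
  -- No letters remain after `w`, so at most `C b` letters `b` remain after padding; this final
  -- count is also `C b + 1 - loss y b`.
  · rw [exec_append] at hexec
    generalize N.exec w _ = c at h0 hexec
    obtain ⟨x, q'⟩ := c
    rw [exec_eq] at hexec
    have h := congrFun (congrArg Prod.fst hexec) b
    have hx := congrFun h0 b
    have h₁ := hC b (d, q')
    simp only [Pi.sub_apply, Pi.zero_apply] at h h₁ hx ⊢
    omega

end AbelianNetwork

/-! ### Stabilization of chip configurations -/

namespace TopplingNetwork

variable {A : Type*} [Fintype A] [DecidableEq A] {S : TopplingNetwork A}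

omit [DecidableEq A] in
theorem loss_add (z z' : A → ℤ) : S.loss (z + z') = S.loss z + S.loss z' := by
  funext b
  simp only [loss, Pi.add_apply, mul_add, Finset.sum_add_distrib]
  ring

theorem loss_single (a b : A) :
    S.loss (Pi.single a 1) b = (if b = a then (S.threshold a : ℤ) else 0) - S.send a b := by
  by_cases h : b = a
  · subst h; simp [loss, Pi.single_apply]
  · simp [loss, Pi.single_apply, h]

theorem topples_iff {σ σ' : A → ℤ} : S.Topples σ σ' ↔
    ∃ a, (S.threshold a : ℤ) ≤ σ a ∧ σ' = σ - S.loss (Pi.single a 1) := by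
  refine exists_congr fun a => and_congr_right fun _ => ?_
  rw [show (σ - S.loss (Pi.single a 1)) =
    fun b => σ b - (if b = a then (S.threshold a : ℤ) else 0) + (S.send a b : ℤ) from
    funext fun b => by rw [Pi.sub_apply, loss_single]; ring]

omit [DecidableEq A] in
/-- Topplings elsewhere do not decrease the number of chips. -/
theorem loss_le_loss {z z' : A → ℤ} (h : z ≤ z') {a : A} (ha : z' a ≤ z a) :
    S.loss z' a ≤ S.loss z a := by
  rw [loss, loss, le_antisymm ha (h a)]
  exact sub_le_sub_left (Finset.sum_le_sum fun c _ => mul_le_mul_of_nonneg_left (h c) (by simp)) _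

/-- The least action principle for chip configurations. -/
theorem exists_loss_of_reflTransGen {σ σ' : A → ℤ} (h : Relation.ReflTransGen S.Topples σ σ') :
    ∃ z, 0 ≤ z ∧ σ' = σ - S.loss z ∧
      ∀ z', 0 ≤ z' → S.IsStable (σ - S.loss z') → z ≤ z' := by
  induction h with
  | refl =>
    refine ⟨0, le_rfl, ?_, fun z' hz' _ => hz'⟩
    funext b
    simp [loss]
  | tail _ htop ih =>
    obtain ⟨z, hz, rfl, hmin⟩ := ih
    obtain ⟨a, ha, rfl⟩ := topples_iff.1 htop
    refine ⟨z + Pi.single a 1, add_nonneg hz (Pi.single_nonneg.2 zero_le_one), ?_, ?_⟩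
    · rw [loss_add, sub_sub]
    · intro z' hz' hst b
      have hle := hmin z' hz' hst
      by_cases hb : b = a
      · subst hb
        -- Otherwise `z` and `z'` agree at `b`, and the further topplings in `z'` only add chips
        -- there; `b` is unstable after `z`, hence also after `z'`.
        by_contra! hlt
        simp only [Pi.add_apply, Pi.single_eq_same] at hlt
        have h₁ := S.loss_le_loss hle (a := b) (by omega)
        have h₂ := hst b
        simp only [Pi.sub_apply] at ha h₂
        omega
      · simpa [hb] using hle b

/-- An unstable letter must topple in any stabilizing vector `z`, so toppling it legally lowers the
total of `z` by one. -/
theorem exists_isStabilization {σ z : A → ℤ} (hz : 0 ≤ z) (hst : S.IsStable (σ - S.loss z)) :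
    ∃ τ, S.IsStabilization σ τ := by
  induction hn : (∑ a, z a).toNat generalizing σ z with
  | zero =>
    have hsum : ∑ a, z a = 0 := le_antisymm (Int.toNat_eq_zero.1 hn)
      (Finset.sum_nonneg fun a _ => hz a)
    have hz0 : z = 0 := funext fun a =>
      (Finset.sum_eq_zero_iff_of_nonneg fun a _ => hz a).1 hsum a (Finset.mem_univ a)
    refine ⟨σ, .refl, ?_⟩
    subst hz0
    intro a
    simpa [loss] using hst a
  | succ n ih =>
    by_cases hσ : S.IsStable σ
    · exact ⟨σ, .refl, hσ⟩
    · obtain ⟨a, ha⟩ := not_forall.1 hσ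
      rw [not_lt] at ha
      have hza : 1 ≤ z a := by
        by_contra! hlt
        have h₁ := S.loss_le_loss hz (a := a) (by simp only [Pi.zero_apply]; omega)
        have h₂ := hst a
        have h₃ : S.loss 0 a = 0 := by simp [loss]
        simp only [Pi.sub_apply] at h₂
        omega
      have hdec : z = Pi.single a 1 + (z - Pi.single a 1) := by abel
      obtain ⟨τ, hτ, hτ'⟩ := ih (σ := σ - S.loss (Pi.single a 1)) (z := z - Pi.single a 1)
        (fun b => by
          by_cases hb : b = a
          · subst hb; simpa using hza
          · simpa [hb] using hz b)
        (by rwa [sub_sub, ← loss_add, ← hdec])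
        (by
          have : ∑ b, (z - Pi.single a 1 : A → ℤ) b = ∑ b, z b - 1 := by
            simp [Finset.sum_sub_distrib]
          omega)
      exact ⟨τ, .head (topples_iff.2 ⟨a, ha, rfl⟩) hτ, hτ'⟩

theorem IsStabilization.unique {σ τ τ' : A → ℤ} (h : S.IsStabilization σ τ)
    (h' : S.IsStabilization σ τ') : τ = τ' := by
  obtain ⟨z, hz, rfl, hmin⟩ := exists_loss_of_reflTransGen h.1
  obtain ⟨z', hz', rfl, hmin'⟩ := exists_loss_of_reflTransGen h'.1
  rw [le_antisymm (hmin z' hz' h'.2) (hmin' z hz h.2)]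

omit [Fintype A] in
/-- A lower bound `-1` on the chip counts persists under legal topplings. -/
theorem neg_one_le_of_reflTransGen {σ σ' : A → ℤ} (h : Relation.ReflTransGen S.Topples σ σ')
    (hσ : ∀ a, -1 ≤ σ a) (a : A) : -1 ≤ σ' a := by
  induction h generalizing a with
  | refl => exact hσ a
  | tail _ htop ih =>
    obtain ⟨c, hc, rfl⟩ := htop
    have := ih a
    dsimp only
    split_ifs with h
    · subst h; omega
    · omega

end TopplingNetwork

/-! ### Odometers as multiples of the reset numbers -/

namespace AbelianNetwork

variable {V : Type*} {G : Digraph V} {A Q : V → Type*}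
variable [∀ v, Finite (Q v)] [DecidableEq V] [∀ v, DecidableEq (A v)]
variable [Fintype V] [∀ v, Fintype (A v)] (N : AbelianNetwork G A Q)

/-- The reset numbers cancel the denominators of `P`, so the rational vector `(I - P) D y` is
integral. -/
theorem correspondingElement_resetNumber_mul {k y : (Σ v, A v) → ℤ}
    (hk : ∀ a, k a = N.resetNumber a * y a) (b : Σ v, A v) :
    N.correspondingElement k b = N.sandpilization.loss y b := by
  rw [correspondingElement, Matrix.sub_mulVec, Matrix.one_mulVec, Pi.sub_apply,
    TopplingNetwork.loss, hk]
  push_cast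
  congr 1
  refine Finset.sum_congr rfl fun a _ => ?_
  have : (N.resetNumber a : ℚ) ≠ 0 := by
    have := N.one_le_resetNumber a
    positivity
  simp only [productionMatrix, Matrix.of_apply, hk, sandpilization]
  push_cast
  field_simp

omit [∀ v, Finite (Q v)] in
theorem resetMatrix_mulVec (y : (Σ v, A v) → ℤ) :
    N.resetMatrix.mulVec (fun b => (y b : ℚ)) =
      fun a => ((N.resetNumber a * y a : ℤ) : ℚ) := by
  funext a
  rw [resetMatrix, Matrix.mulVec_diagonal]
  push_cast
  rfl

theorem laplacian_mulVec (y : (Σ v, A v) → ℤ) (b : Σ v, A v) :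
    N.laplacian.mulVec (fun b => (y b : ℚ)) b = N.sandpilization.loss y b := by
  rw [laplacian, ← Matrix.mulVec_mulVec, resetMatrix_mulVec]
  exact N.correspondingElement_resetNumber_mul (k := fun a => N.resetNumber a * y a)
    (fun _ => rfl) b

variable {N}

theorem mem_burningOdometers_iff (hrect : N.IsRectangular) {k : (Σ v, A v) → ℤ} :
    k ∈ N.burningOdometers ↔ ∃ y, (∀ a, k a = N.resetNumber a * y a) ∧ 1 ≤ y ∧
      0 ≤ N.sandpilization.loss y := by
  have hr : ∀ a, (1 : ℤ) ≤ N.resetNumber a := fun a => by exact_mod_cast N.one_le_resetNumber a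
  rw [burningOdometers, Set.mem_ofPred_eq, hrect, Set.mem_ofPred_eq]
  constructor
  · rintro ⟨h₁, h₂, h₃⟩
    choose y hy using h₃
    refine ⟨y, hy, fun a => ?_, fun a => ?_⟩
    · have h₄ : (1 : ℤ) ≤ k a := h₂ a
      rw [hy a] at h₄
      exact pos_of_mul_pos_right (a := (N.resetNumber a : ℤ)) h₄ (zero_le_one.trans (hr a))
    · have := h₁ a
      rw [N.correspondingElement_resetNumber_mul hy] at this
      exact Int.cast_nonneg_iff.1 this
  · rintro ⟨y, hy, h₁, h₂⟩
    refine ⟨fun a => ?_, fun a => ?_, fun a => ⟨y a, hy a⟩⟩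
    · rw [N.correspondingElement_resetNumber_mul hy]
      exact Int.cast_nonneg_iff.2 (h₂ a)
    · rw [hy a]
      exact one_le_mul_of_one_le_of_one_le (hr a) (h₁ a)

end AbelianNetwork

/-! ### The smallest burning odometer -/

theorem corollary5p6 {V : Type*} [Fintype V] [DecidableEq V] {G : Digraph V} {A Q : V → Type*}
    [∀ v, Fintype (A v)] [∀ v, DecidableEq (A v)] [∀ v, Finite (Q v)]
    (N : AbelianNetwork G A Q) (hirr : N.IsIrreducible) (hrect : N.IsRectangular)
    (hhalt : N.HaltsOnAllInputs) :
    ∃ k y β : (Σ v, A v) → ℤ,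
      -- `k = D y` is the pointwise smallest burning odometer
      IsLeast N.burningOdometers k ∧
      (∀ a, (k a : ℚ) = N.resetMatrix.mulVec (fun b => (y b : ℚ)) a) ∧
      -- `β` is the corresponding burning element, and `β = L y`
      (∀ a, (β a : ℚ) = N.correspondingElement k a) ∧
      N.IsBurningElement β ∧
      (∀ a, (β a : ℚ) = N.laplacian.mulVec (fun b => (y b : ℚ)) a) ∧
      -- `σ = r - 1 - L 1` is integral, it has a unique stabilization `σ°`, and `β = r - 1 - σ°`
      (∃ σ τ : (Σ v, A v) → ℤ,
        (∀ a, (σ a : ℚ) = (N.resetNumber a : ℚ) - 1 - N.laplacian.mulVec 1 a) ∧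
        (∀ τ', N.sandpilization.IsStabilization σ τ' ↔ τ' = τ) ∧
        ∀ a, β a = (N.resetNumber a : ℤ) - 1 - τ a) ∧
      ∀ a, 0 ≤ β a ∧ β a ≤ (N.resetNumber a : ℤ) := by
  set S := N.sandpilization with hS
  set σ : (Σ v, A v) → ℤ := fun a => (N.resetNumber a : ℤ) - 1 - S.loss 1 a with hσ
  have hstab : ∀ z : (Σ v, A v) → ℤ, S.IsStable (σ - S.loss z) ↔ 0 ≤ S.loss (1 + z) := by
    intro z
    -- The terms `r - 1` in `σ` turn the strict inequality of stability into nonnegativity of the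
    -- loss.
    refine forall_congr' fun a => ?_
    rw [TopplingNetwork.loss_add]
    change (N.resetNumber a : ℤ) - 1 - S.loss 1 a - S.loss z a < (N.resetNumber a : ℤ) ↔
      0 ≤ S.loss 1 a + S.loss z a
    omega
  have hσ' : ∀ a, -1 ≤ σ a := by
    intro a
    have : 0 ≤ ∑ c, (S.send c a : ℤ) := Finset.sum_nonneg fun c _ => by positivity
    -- Thus `σ a + 1` is the number of chips that `a` receives when every letter topples once.
    have h₁ : S.loss 1 a = N.resetNumber a - ∑ c, (S.send c a : ℤ) := by
      simp [TopplingNetwork.loss, hS, AbelianNetwork.sandpilization]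
    simp only [hσ, h₁]
    omega
  have hmin : ∀ z', 0 ≤ S.loss z' → S.IsStable (σ - S.loss (z' - 1)) := by
    intro z' h
    rwa [hstab, add_sub_cancel]
  obtain ⟨y₀, hy₀, hloss₀⟩ := AbelianNetwork.exists_one_le_loss_nonneg hirr hhalt
  obtain ⟨τ, hτ⟩ := TopplingNetwork.exists_isStabilization (sub_nonneg.2 hy₀) (hmin y₀ hloss₀)
  obtain ⟨z, hz, hτz, hleast⟩ := TopplingNetwork.exists_loss_of_reflTransGen hτ.1
  have hy : (1 : (Σ v, A v) → ℤ) ≤ 1 + z := le_add_of_nonneg_right hz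
  have hloss : 0 ≤ S.loss (1 + z) := (hstab z).1 (hτz ▸ hτ.2)
  have hβ : ∀ a, S.loss (1 + z) a = (N.resetNumber a : ℤ) - 1 - τ a := by
    intro a
    rw [hτz, TopplingNetwork.loss_add]
    simp only [hσ, Pi.add_apply, Pi.sub_apply]
    ring
  refine ⟨fun a => N.resetNumber a * (1 + z) a, 1 + z, S.loss (1 + z), ⟨?_, ?_⟩, ?_, ?_,
    AbelianNetwork.isBurningElement_loss hirr hhalt hy hloss, ?_, ⟨σ, τ, ?_, ?_, hβ⟩, ?_⟩
  · exact (AbelianNetwork.mem_burningOdometers_iff hrect).2 ⟨1 + z, fun _ => rfl, hy, hloss⟩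
  · intro k hk a
    obtain ⟨y, hky, hy1, hyloss⟩ := (AbelianNetwork.mem_burningOdometers_iff hrect).1 hk
    rw [hky a]
    refine mul_le_mul_of_nonneg_left ?_ (by positivity)
    -- Any odometer `D y` makes `y - 1` a stabilizing vector for `σ`, so it dominates the legal
    -- toppling vector `z`.
    have := hleast (y - 1) (sub_nonneg.2 hy1) (hmin y hyloss) a
    simp only [Pi.add_apply, Pi.sub_apply] at this ⊢
    omega
  · exact fun a => (congrFun (N.resetMatrix_mulVec (1 + z)) a).symm
  · exact fun a => (N.correspondingElement_resetNumber_mul (fun _ => rfl) a).symm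
  · exact fun a => (N.laplacian_mulVec (1 + z) a).symm
  · intro a
    have h := N.laplacian_mulVec 1 a
    have h₁ : (fun b => (((1 : (Σ v, A v) → ℤ) b : ℤ) : ℚ)) = 1 := by
      funext b; simp
    rw [h₁] at h
    rw [h, hσ]
    push_cast
    rfl
  · exact fun τ' => ⟨fun h => h.unique hτ, fun h => h ▸ hτ⟩
  · intro a
    refine ⟨hloss a, ?_⟩
    have := TopplingNetwork.neg_one_le_of_reflTransGen hτ.1 hσ' a
    rw [hβ]
    omega
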